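/- Let $\Lambda=\prod_{j=1}^d (a_j,b_j)\subset\mathbb{R}^d$ with $a_j,b_j\in\mathbb{R}\cup\{\pm\infty\}$, $a_j<b_j$, and let $V\colon\Lambda\to\mathbb{R}$ be measurable and admissible on $\Lambda$, that is, the domain $\mathcal{D}(V)=\{\psi\in L^2(\Lambda): V\psi\in L^2(\Lambda)\}$ of the multiplication operator by $V$ in the complex Hilbert space $L^2(\Lambda)$ contains $H^1(\Lambda)$. For $\bullet\in\{D,N,\mathrm{per}\}$ let $-\Delta_\Lambda^\bullet$ be the Dirichlet, Neumann, respectively periodic Laplacian on $\Lambda$, i.e. the self-adjoint operator associated with the form $\int_\Lambda \nabla u\cdot\overline{\nabla v}$ on $H^1_0(\Lambda)$, $H^1(\Lambda)$, respectively $H^1_{\mathrm{per}}(\Lambda)$; the case $\bullet=\mathrm{per}$ is considered only if each interval $(a_j,b_j)$ is bounded or equal to $\mathbb{R}$, and $H^1_{\mathrm{per}}(\Lambda)$ consists of the $u\in H^1(\Lambda)$ whose traces on opposite faces of $\Lambda$ in the bounded directions coincide. Then: (a) For each such $\bullet$, $V$ is infinitesimally operator bounded with respect to $\Delta_\Lambda^\bullet$: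 $\mathcal{D}(\Delta_\Lambda^\bullet)\subset\mathcal{D}(V)$, and for every $\eta>0$ there is $C\ge 0$ with $\|V\psi\|\le\eta\|\Delta_\Lambda^\bullet\psi\|+C\|\psi\|$ for all $\psi\in\mathcal{D}(\Delta_\Lambda^\bullet)$. More precisely, there are constants $a,b\ge 0$ such that $$\|V\psi\|_{L^2(\Lambda)}\le a\varepsilon\,\|\Delta_\Lambda^\bullet\psi\|_{L^2(\Lambda)}+\Bigl(\frac a\varepsilon+b\Bigr)\|\psi\|_{L^2(\Lambda)}$$ for all $\psi\in\mathcal{D}(\Delta_\Lambda^\bullet)$ and all $\varepsilon>0$. (b) There are constants $\lambda_1,\lambda_2\ge 0$ such that $$\|V\psi\|_{L^2(\Lambda)}^2\le\lambda_1\|\nabla\psi\|_{L^2(\Lambda)}^2+\lambda_2\|\psi\|_{L^2(\Lambda)}^2$$ for all $\psi\in H^1(\Lambda)$. -/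

import Mathlib

open MeasureTheory TopologicalSpace
open scoped ContDiff

noncomputable section

namespace GenRect

/-- The space `ℝ^d` with its Euclidean structure. -/
abbrev Space (d : ℕ) := EuclideanSpace ℝ (Fin d)

/-- The `j`-th classical partial derivative of a scalar function on `ℝ^d`. -/
def partialDeriv {d : ℕ} (j : Fin d) (φ : Space d → ℝ) (x : Space d) : ℝ :=
  fderiv ℝ φ x (EuclideanSpace.single j 1)

/-- The generalized rectangle `⨉_j (a_j, b_j)`, where `a_j` and `b_j` may be infinite. -/
def box {d : ℕ} (a b : Fin d → EReal) : Opens (Space d) where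
  carrier := {x | ∀ j, a j < ((x j : ℝ) : EReal) ∧ ((x j : ℝ) : EReal) < b j}
  is_open' := by
    have hc : ∀ j, Continuous fun x : Space d => ((x j : ℝ) : EReal) := fun j =>
      continuous_coe_real_ereal.comp (EuclideanSpace.proj (𝕜 := ℝ) j).continuous
    simp only [Set.ofPred_forall]
    exact isOpen_iInter_of_finite fun j =>
      (isOpen_lt continuous_const (hc j)).inter (isOpen_lt (hc j) continuous_const)

/-- The complex Hilbert space `L²(Λ)`. -/
abbrev L2 {d : ℕ} (Λ : Opens (Space d)) := Lp ℂ 2 (volume.restrict (Λ : Set (Space d)))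

/-- The complex Hilbert space `L²(Λ)^d` of vector fields, with norm
`‖g‖² = ∑ j, ‖g j‖²`. -/
abbrev L2Field {d : ℕ} (Λ : Opens (Space d)) := PiLp 2 (fun _ : Fin d => L2 Λ)

/-- The space of all `ψ ∈ L²(Λ)` with `V ψ ∈ L²(Λ)`. -/
def mulDomain {d : ℕ} (Λ : Opens (Space d)) (V : Space d → ℝ) : Submodule ℂ (L2 Λ) where
  carrier := {ψ | MemLp (fun x => (V x : ℂ) * ψ x) 2 (volume.restrict (Λ : Set (Space d)))}
  zero_mem' := by
    refine (memLp_congr_ae ?_).2 (MemLp.zero' (ε := ℂ))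
    filter_upwards [Lp.coeFn_zero ℂ 2 (volume.restrict (Λ : Set (Space d)))] with x hx
    rw [hx, Pi.zero_apply, mul_zero]
  add_mem' := by
    intro u v hu hv
    refine (memLp_congr_ae ?_).2 (MemLp.add hu hv)
    filter_upwards [Lp.coeFn_add u v] with x hx
    rw [hx, Pi.add_apply, Pi.add_apply, mul_add]
  smul_mem' := by
    intro c u hu
    refine (memLp_congr_ae ?_).2 (MemLp.const_smul hu c)
    filter_upwards [Lp.coeFn_smul c u] with x hx
    rw [hx, Pi.smul_apply, Pi.smul_apply, smul_eq_mul, smul_eq_mul, mul_left_comm]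

/-- The class of `V ψ` in `L²(Λ)`. -/
def mulFun {d : ℕ} (Λ : Opens (Space d)) (V : Space d → ℝ) (ψ : L2 Λ) (hψ : ψ ∈ mulDomain Λ V) :
    L2 Λ :=
  MemLp.toLp (fun x => (V x : ℂ) * ψ x) hψ

lemma coeFn_mulFun {d : ℕ} (Λ : Opens (Space d)) (V : Space d → ℝ) (ψ : L2 Λ)
    (hψ : ψ ∈ mulDomain Λ V) :
    mulFun Λ V ψ hψ =ᵐ[volume.restrict (Λ : Set (Space d))] fun x => (V x : ℂ) * ψ x :=
  MemLp.coeFn_toLp hψ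

lemma mulFun_add {d : ℕ} (Λ : Opens (Space d)) (V : Space d → ℝ) (u v : L2 Λ)
    (hu : u ∈ mulDomain Λ V) (hv : v ∈ mulDomain Λ V) (huv : u + v ∈ mulDomain Λ V) :
    mulFun Λ V (u + v) huv = mulFun Λ V u hu + mulFun Λ V v hv := by
  apply Lp.ext
  filter_upwards [Lp.coeFn_add u v, Lp.coeFn_add (mulFun Λ V u hu) (mulFun Λ V v hv),
    coeFn_mulFun Λ V u hu, coeFn_mulFun Λ V v hv, coeFn_mulFun Λ V _ huv] with x h1 h2 h3 h4 h5
  rw [h2, h5, h1, Pi.add_apply, Pi.add_apply, h3, h4, mul_add]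

lemma mulFun_smul {d : ℕ} (Λ : Opens (Space d)) (V : Space d → ℝ) (c : ℂ) (u : L2 Λ)
    (hu : u ∈ mulDomain Λ V) (hcu : c • u ∈ mulDomain Λ V) :
    mulFun Λ V (c • u) hcu = c • mulFun Λ V u hu := by
  apply Lp.ext
  filter_upwards [Lp.coeFn_smul c u, Lp.coeFn_smul c (mulFun Λ V u hu),
    coeFn_mulFun Λ V u hu, coeFn_mulFun Λ V _ hcu] with x h1 h2 h3 h5
  rw [h2, h5, h1, Pi.smul_apply, Pi.smul_apply, h3, smul_eq_mul, smul_eq_mul, mul_left_comm]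

/-- The maximal multiplication operator `ψ ↦ V ψ` in `L²(Λ)`. -/
def mulOp {d : ℕ} (Λ : Opens (Space d)) (V : Space d → ℝ) : L2 Λ →ₗ.[ℂ] L2 Λ where
  domain := mulDomain Λ V
  toFun :=
    { toFun := fun ψ => mulFun Λ V ψ.1 ψ.2
      map_add' := fun u v => mulFun_add Λ V u.1 v.1 u.2 v.2 (u + v).2
      map_smul' := fun c u => mulFun_smul Λ V c u.1 u.2 (c • u).2 }

lemma integral_smul_zero {d : ℕ} (Λ : Opens (Space d)) (χ : Space d → ℝ) :
    ∫ x in (Λ : Set (Space d)), χ x • (0 : L2 Λ) x = 0 := by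
  refine integral_eq_zero_of_ae ?_
  filter_upwards [Lp.coeFn_zero ℂ 2 (volume.restrict (Λ : Set (Space d)))] with x hx
  rw [hx, Pi.zero_apply, smul_zero]

lemma memLp_of_isBounded {d : ℕ} (Λ : Opens (Space d)) {φ : Space d → ℝ} (hφ : Continuous φ)
    (hb : Bornology.IsBounded ((Λ : Set (Space d)) ∩ Function.support φ)) :
    MemLp φ 2 (volume.restrict (Λ : Set (Space d))) := by
  set s := (Λ : Set (Space d)) ∩ Function.support φ with hs
  have hsm : MeasurableSet s :=
    Λ.isOpen.measurableSet.inter (hφ.measurable (measurableSet_singleton 0).compl)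
  have hK : IsCompact (closure s) := hb.isCompact_closure
  obtain ⟨C, hC⟩ := hK.exists_bound_of_continuousOn hφ.continuousOn
  have h1 : MemLp (s.indicator φ) 2 (volume.restrict (Λ : Set (Space d))) := by
    rw [memLp_indicator_iff_restrict hsm]
    have : IsFiniteMeasure ((volume.restrict (Λ : Set (Space d))).restrict s) := by
      constructor
      rw [Measure.restrict_apply_univ]
      exact (Measure.restrict_apply_le _ _).trans_lt hb.measure_lt_top
    refine MemLp.of_bound hφ.aestronglyMeasurable C ?_
    filter_upwards [ae_restrict_mem hsm] with x hx using hC x (subset_closure hx)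
  refine (memLp_congr_ae ?_).2 h1
  filter_upwards [ae_restrict_mem Λ.isOpen.measurableSet] with x hx
  by_cases h0 : φ x = 0
  · simp [Set.indicator, h0]
  · rw [Set.indicator_of_mem]
    exact ⟨hx, h0⟩

lemma isBounded_partialDeriv {d : ℕ} (Λ : Opens (Space d)) {φ : Space d → ℝ} (j : Fin d)
    (hb : Bornology.IsBounded ((Λ : Set (Space d)) ∩ Function.support φ)) :
    Bornology.IsBounded ((Λ : Set (Space d)) ∩ Function.support (partialDeriv j φ)) := by
  refine hb.closure.subset fun x hx => ?_
  have h2 : x ∈ tsupport φ := by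
    by_contra hn
    apply hx.2
    have : fderiv ℝ φ x = 0 := by
      by_contra h
      exact hn (support_fderiv_subset ℝ h)
    simp [partialDeriv, this]
  exact Λ.isOpen.inter_closure ⟨hx.1, h2⟩

lemma continuous_partialDeriv {d : ℕ} {φ : Space d → ℝ} (j : Fin d) (hφ : ContDiff ℝ ∞ φ) :
    Continuous (partialDeriv j φ) :=
  (hφ.continuous_fderiv (by simp)).clm_apply continuous_const

lemma integrable_smul_L2 {d : ℕ} (Λ : Opens (Space d)) {φ : Space d → ℝ} (hφ : Continuous φ)
    (hb : Bornology.IsBounded ((Λ : Set (Space d)) ∩ Function.support φ)) (u : L2 Λ) :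
    Integrable (fun x => φ x • u x) (volume.restrict (Λ : Set (Space d))) := by
  have := (memLp_of_isBounded Λ hφ hb).ofReal (K := ℂ)
  have h := MemLp.integrable_mul this (Lp.memLp u)
  refine h.congr (Filter.Eventually.of_forall fun x => ?_)
  simp

/-- All pairs `(u, g) ∈ L²(Λ) × L²(Λ)^d` with `∫_Λ (∂_j φ) u = - ∫_Λ φ g_j` for all `j` and all
smooth `φ : ℝ^d → ℝ` such that `φ` has bounded support within `Λ` and satisfies `P`. -/
def partsGraph {d : ℕ} (Λ : Opens (Space d)) (P : (Space d → ℝ) → Prop) :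
    Submodule ℂ (L2 Λ × L2Field Λ) where
  carrier := {p | ∀ (j : Fin d) (φ : Space d → ℝ), ContDiff ℝ ∞ φ →
    Bornology.IsBounded ((Λ : Set (Space d)) ∩ Function.support φ) → P φ →
    ∫ x in (Λ : Set (Space d)), partialDeriv j φ x • p.1 x
      = - ∫ x in (Λ : Set (Space d)), φ x • p.2 j x}
  zero_mem' := by
    intro j φ hφ hb hP
    have h1 := integral_smul_zero Λ (partialDeriv j φ)
    have h2 := integral_smul_zero Λ φ
    simp only [Prod.fst_zero, Prod.snd_zero, PiLp.zero_apply]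
    rw [h1, h2, neg_zero]
  add_mem' := by
    intro p q hp hq j φ hφ hb hP
    have key : ∀ χ : Space d → ℝ, Continuous χ →
        Bornology.IsBounded ((Λ : Set (Space d)) ∩ Function.support χ) → ∀ u v : L2 Λ,
        ∫ x in (Λ : Set (Space d)), χ x • (u + v : L2 Λ) x =
          (∫ x in (Λ : Set (Space d)), χ x • u x) + ∫ x in (Λ : Set (Space d)), χ x • v x := by
      intro χ hχ hχb u v
      rw [← integral_add (integrable_smul_L2 Λ hχ hχb u) (integrable_smul_L2 Λ hχ hχb v)]
      refine integral_congr_ae ?_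
      filter_upwards [Lp.coeFn_add u v] with x hx
      rw [hx, Pi.add_apply, smul_add]
    have h1 := key _ (continuous_partialDeriv j hφ) (isBounded_partialDeriv Λ j hb) p.1 q.1
    have h2 := key _ hφ.continuous hb (p.2 j) (q.2 j)
    simp only [Prod.fst_add, Prod.snd_add, PiLp.add_apply]
    rw [h1, h2, hp j φ hφ hb hP, hq j φ hφ hb hP]
    ring
  smul_mem' := by
    intro c p hp j φ hφ hb hP
    have key : ∀ (χ : Space d → ℝ) (u : L2 Λ),
        ∫ x in (Λ : Set (Space d)), χ x • (c • u : L2 Λ) x =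
          c * ∫ x in (Λ : Set (Space d)), χ x • u x := by
      intro χ u
      rw [← integral_const_mul]
      refine integral_congr_ae ?_
      filter_upwards [Lp.coeFn_smul c u] with x hx
      simp only [hx, Pi.smul_apply, smul_eq_mul, Complex.real_smul]
      ring
    simp only [Prod.smul_fst, Prod.smul_snd, PiLp.smul_apply]
    rw [key, key, hp j φ hφ hb hP]
    ring

/-- The condition that makes a smooth `φ` a test function on `Λ`, i.e. an element of
`C_c^∞(Λ)`. -/
def CompactlySupportedIn {d : ℕ} (Λ : Opens (Space d)) {F : Type*} [Zero F]
    (φ : Space d → F) : Prop :=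
  HasCompactSupport φ ∧ tsupport φ ⊆ (Λ : Set (Space d))

/-- The pairs `(u, ∇u)`, where `u ∈ L²(Λ)` has weak (distributional) gradient
`∇u ∈ L²(Λ)^d`. -/
def gradGraph {d : ℕ} (Λ : Opens (Space d)) : Submodule ℂ (L2 Λ × L2Field Λ) :=
  partsGraph Λ (CompactlySupportedIn Λ)

/-- The gradient as an operator from `L²(Λ)` to `L²(Λ)^d` with domain `H¹(Λ)`, given by the weak
derivatives (`grad_graph` below shows that the weak gradient is unique). -/
def grad {d : ℕ} (Λ : Opens (Space d)) : L2 Λ →ₗ.[ℂ] L2Field Λ :=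
  (gradGraph Λ).toLinearPMap

/-- The Sobolev space `H¹(Λ)` as a subspace of `L²(Λ)`. -/
def H1 {d : ℕ} (Λ : Opens (Space d)) : Submodule ℂ (L2 Λ) := (grad Λ).domain

/-- `V` is admissible on `Λ`: it is (Lebesgue) measurable on `Λ`, and the domain of the
multiplication operator by `V` contains `H¹(Λ)`. -/
def IsAdmissible {d : ℕ} (Λ : Opens (Space d)) (V : Space d → ℝ) : Prop :=
  AEMeasurable V (volume.restrict (Λ : Set (Space d))) ∧ H1 Λ ≤ (mulOp Λ V).domain

/-- The subspace of `L²(Λ)` formed by the (classes of) functions in `C_c^∞(Λ)`. -/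
def testSpace {d : ℕ} (Λ : Opens (Space d)) : Submodule ℂ (L2 Λ) where
  carrier := {u | ∃ φ : Space d → ℂ, ContDiff ℝ ∞ φ ∧ CompactlySupportedIn Λ φ ∧
    u =ᵐ[volume.restrict (Λ : Set (Space d))] φ}
  zero_mem' := ⟨0, contDiff_const, by simp [CompactlySupportedIn, HasCompactSupport], Lp.coeFn_zero _ _ _⟩
  add_mem' := by
    rintro u v ⟨φ, h1, ⟨h2, h3⟩, h4⟩ ⟨χ, k1, ⟨k2, k3⟩, k4⟩
    refine ⟨φ + χ, h1.add k1, ⟨h2.add k2, ?_⟩, ?_⟩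
    · exact (tsupport_add φ χ).trans (Set.union_subset h3 k3)
    · filter_upwards [Lp.coeFn_add u v, h4, k4] with x hx hx1 hx2
      rw [hx, Pi.add_apply, Pi.add_apply, hx1, hx2]
  smul_mem' := by
    rintro c u ⟨φ, h1, ⟨h2, h3⟩, h4⟩
    have hsub : tsupport (fun x => c • φ x) ⊆ tsupport φ :=
      tsupport_smul_subset_right (fun _ => c) φ
    refine ⟨fun x => c • φ x, h1.const_smul c, ⟨?_, hsub.trans h3⟩, ?_⟩
    · exact h2.of_isClosed_subset (isClosed_tsupport _) hsub
    · filter_upwards [Lp.coeFn_smul c u, h4] with x hx hx1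
      rw [hx, Pi.smul_apply, hx1]

/-- The three boundary conditions: Dirichlet, Neumann and periodic. -/
inductive BoundaryCondition
  | dirichlet
  | neumann
  | periodic

/-- Dirichlet and Neumann conditions always make sense. Periodic conditions make sense if each
interval `(a_j, b_j)` is bounded or the whole line. -/
def BoundaryCondition.Applicable {d : ℕ} (a b : Fin d → EReal) : BoundaryCondition → Prop
  | dirichlet => True
  | neumann => True
  | periodic => ∀ j, (a j ≠ ⊥ ∧ b j ≠ ⊤) ∨ (a j = ⊥ ∧ b j = ⊤)

/-- `φ : ℝ^d → ℝ` is `(b_j - a_j)`-periodic in each direction `j` with `(a_j, b_j)` bounded. -/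
def IsBoxPeriodic {d : ℕ} (a b : Fin d → EReal) (φ : Space d → ℝ) : Prop :=
  ∀ j, a j ≠ ⊥ → b j ≠ ⊤ → ∀ x,
    φ (x + EuclideanSpace.single j ((b j).toReal - (a j).toReal)) = φ x

/-- The pairs `(u, ∇u)` for `u` in the form domain of the Laplacian on `Λ = ⨉_j (a_j, b_j)`:
* Dirichlet: `u ∈ H¹₀(Λ)`, the closure of `C_c^∞(Λ)` in `H¹(Λ)`;
* Neumann: `u ∈ H¹(Λ)`;
* periodic: `u ∈ H¹_per(Λ)`, the functions in `H¹(Λ)` for which integration by parts against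
  smooth periodic functions produces no boundary terms (that is, the traces of `u` on opposite faces
  coincide). -/
def formGraph {d : ℕ} (a b : Fin d → EReal) :
    BoundaryCondition → Submodule ℂ (L2 (box a b) × L2Field (box a b))
  | .dirichlet =>
      (gradGraph (box a b) ⊓
        (testSpace (box a b)).comap (LinearMap.fst ℂ _ _)).topologicalClosure ⊓
          gradGraph (box a b)
  | .neumann => gradGraph (box a b)
  | .periodic => gradGraph (box a b) ⊓ partsGraph (box a b) (IsBoxPeriodic a b)

/-- The pairs `(u, Δu)`, where `u` is in the form domain and `Δu ∈ L²(Λ)` satisfies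
`⟨∇v, ∇u⟩ = ⟨v, -Δu⟩` for all `v` in the form domain. -/
def laplacianGraph {d : ℕ} (a b : Fin d → EReal) (bc : BoundaryCondition) :
    Submodule ℂ (L2 (box a b) × L2 (box a b)) where
  carrier := {p | ∃ g, (p.1, g) ∈ formGraph a b bc ∧
    ∀ v h, (v, h) ∈ formGraph a b bc → inner ℂ h g = inner ℂ v (-p.2)}
  zero_mem' := ⟨0, (formGraph a b bc).zero_mem, fun v h _ => by simp⟩
  add_mem' := by
    rintro p q ⟨g, hg, h1⟩ ⟨k, hk, h2⟩
    refine ⟨g + k, (formGraph a b bc).add_mem hg hk, fun v h hv => ?_⟩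
    rw [inner_add_right, h1 v h hv, h2 v h hv, ← inner_add_right, Prod.snd_add, neg_add]
  smul_mem' := by
    rintro c p ⟨g, hg, h1⟩
    refine ⟨c • g, (formGraph a b bc).smul_mem c hg, fun v h hv => ?_⟩
    rw [inner_smul_right, h1 v h hv, ← inner_smul_right, Prod.smul_snd, smul_neg]

/-- The Laplacian `Δ_Λ^•` on `L²(Λ)`, `Λ = ⨉_j (a_j, b_j)`, with the given boundary condition:
minus the self-adjoint operator associated with the form `∫_Λ ∇u · ∇v̄` on the form domain
(`laplacian_graph` below shows that `Δu` is unique). -/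
def laplacian {d : ℕ} (a b : Fin d → EReal) (bc : BoundaryCondition) :
    L2 (box a b) →ₗ.[ℂ] L2 (box a b) :=
  (laplacianGraph a b bc).toLinearPMap

/-- `B` is infinitesimally operator bounded with respect to `A`: the domain of `B` contains that
of `A`, and `B` is relatively bounded with respect to `A` with arbitrarily small relative bound. -/
def IsInfinitesimallyBounded {X Y Z : Type*} [NormedAddCommGroup X] [NormedSpace ℂ X]
    [NormedAddCommGroup Y] [NormedSpace ℂ Y] [NormedAddCommGroup Z] [NormedSpace ℂ Z]
    (B : X →ₗ.[ℂ] Z) (A : X →ₗ.[ℂ] Y) : Prop :=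
  A.domain ≤ B.domain ∧ ∀ η : ℝ, 0 < η → ∃ C : ℝ, 0 ≤ C ∧
    ∀ (x : X) (hA : x ∈ A.domain) (hB : x ∈ B.domain),
      ‖B ⟨x, hB⟩‖ ≤ η * ‖A ⟨x, hA⟩‖ + C * ‖x‖

/-! Well-definedness of the gradient and of the Laplacians. -/

lemma eq_zero_of_forall_test {d : ℕ} (Λ : Opens (Space d)) (u : L2 Λ)
    (h : ∀ φ : Space d → ℝ, ContDiff ℝ ∞ φ → CompactlySupportedIn Λ φ →
      ∫ x in (Λ : Set (Space d)), φ x • u x = 0) : u = 0 := by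
  rw [Lp.eq_zero_iff_ae_eq_zero]
  have hloc : LocallyIntegrableOn u (Λ : Set (Space d)) volume := by
    intro x hx
    have h1 : LocallyIntegrable u (volume.restrict (Λ : Set (Space d))) :=
      (Lp.memLp u).locallyIntegrable (by norm_num)
    obtain ⟨s, hs, hsi⟩ := h1 x
    refine ⟨s ∩ Λ, ?_, ?_⟩
    · exact Filter.inter_mem (mem_nhdsWithin_of_mem_nhds hs) self_mem_nhdsWithin
    · rw [IntegrableOn, Measure.restrict_restrict' Λ.isOpen.measurableSet] at hsi
      exact hsi
  have := Λ.isOpen.ae_eq_zero_of_integral_contDiff_smul_eq_zero hloc ?_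
  · exact (ae_restrict_iff' Λ.isOpen.measurableSet).2 this
  · intro φ h1 h2 h3
    rw [← h φ h1 ⟨h2, h3⟩, setIntegral_eq_integral_of_forall_compl_eq_zero]
    intro x hx
    have : φ x = 0 := image_eq_zero_of_notMem_tsupport fun h => hx (h3 h)
    simp [this]

lemma isBounded_of_compactlySupportedIn {d : ℕ} (Λ : Opens (Space d)) {φ : Space d → ℝ}
    (h : CompactlySupportedIn Λ φ) :
    Bornology.IsBounded ((Λ : Set (Space d)) ∩ Function.support φ) :=
  h.1.isBounded.subset (Set.inter_subset_right.trans (subset_tsupport φ))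

lemma gradGraph_single_valued {d : ℕ} (Λ : Opens (Space d)) (p : L2 Λ × L2Field Λ)
    (hp : p ∈ gradGraph Λ) (h0 : p.1 = 0) : p.2 = 0 := by
  refine PiLp.ext fun j => eq_zero_of_forall_test Λ _ fun φ h1 h2 => ?_
  have h := hp j φ h1 (isBounded_of_compactlySupportedIn Λ h2) h2
  rw [h0] at h
  rw [integral_smul_zero] at h
  exact neg_eq_zero.1 h.symm

/-- The graph of the gradient consists exactly of the pairs `(u, ∇u)`. -/
theorem grad_graph {d : ℕ} (Λ : Opens (Space d)) : (grad Λ).graph = gradGraph Λ :=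
  Submodule.toLinearPMap_graph_eq _ (gradGraph_single_valued Λ)

lemma memLp_ofReal {d : ℕ} (Λ : Opens (Space d)) {φ : Space d → ℝ} (h1 : Continuous φ)
    (hb : Bornology.IsBounded ((Λ : Set (Space d)) ∩ Function.support φ)) :
    MemLp (fun x => (φ x : ℂ)) 2 (volume.restrict (Λ : Set (Space d))) :=
  (memLp_of_isBounded Λ h1 hb).ofReal (K := ℂ)

lemma test_mem_partsGraph {d : ℕ} (Λ : Opens (Space d)) (P : (Space d → ℝ) → Prop)
    {φ : Space d → ℝ} (h1 : ContDiff ℝ ∞ φ) (h2 : CompactlySupportedIn Λ φ) :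
    ((memLp_ofReal Λ h1.continuous (isBounded_of_compactlySupportedIn Λ h2)).toLp _,
      WithLp.toLp 2 fun j => (memLp_ofReal Λ (continuous_partialDeriv j h1)
        (isBounded_partialDeriv Λ j (isBounded_of_compactlySupportedIn Λ h2))).toLp _)
      ∈ partsGraph Λ P := by
  intro j χ hχ _ _
  have hzero : ∀ x ∉ (Λ : Set (Space d)), φ x = 0 ∧ partialDeriv j φ x = 0 := by
    intro x hx
    have hx' : x ∉ tsupport φ := fun h => hx (h2.2 h)
    refine ⟨image_eq_zero_of_notMem_tsupport hx', ?_⟩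
    have : fderiv ℝ φ x = 0 := by
      by_contra h
      exact hx' (support_fderiv_subset ℝ h)
    simp [partialDeriv, this]
  have hcs : HasCompactSupport (partialDeriv j φ) := h2.1.fderiv_apply ℝ _
  have parts : ∫ x, φ x * partialDeriv j χ x = - ∫ x, partialDeriv j φ x * χ x := by
    refine integral_mul_fderiv_eq_neg_fderiv_mul_of_integrable ?_ ?_ ?_
      (fun x _ => (h1.differentiable (by simp)) x) (fun x _ => (hχ.differentiable (by simp)) x)
    · exact ((continuous_partialDeriv j h1).mul hχ.continuous).integrable_of_hasCompactSupport
        hcs.mul_right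
    · exact (h1.continuous.mul (continuous_partialDeriv j hχ)).integrable_of_hasCompactSupport
        h2.1.mul_right
    · exact (h1.continuous.mul hχ.continuous).integrable_of_hasCompactSupport h2.1.mul_right
  have e1 : ∫ x in (Λ : Set (Space d)), partialDeriv j χ x •
      ((memLp_ofReal Λ h1.continuous (isBounded_of_compactlySupportedIn Λ h2)).toLp _ : L2 Λ) x
      = ((∫ x, φ x * partialDeriv j χ x : ℝ) : ℂ) := by
    rw [← integral_complex_ofReal, ← setIntegral_eq_integral_of_forall_compl_eq_zero
      (s := (Λ : Set (Space d))) (f := fun x => ((φ x * partialDeriv j χ x : ℝ) : ℂ))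
      (fun x hx => by simp [(hzero x hx).1])]
    refine integral_congr_ae ?_
    filter_upwards [MemLp.coeFn_toLp (memLp_ofReal Λ h1.continuous
      (isBounded_of_compactlySupportedIn Λ h2))] with x hx
    rw [hx]
    simp [mul_comm]
  have e2 : ∫ x in (Λ : Set (Space d)), χ x •
      ((memLp_ofReal Λ (continuous_partialDeriv j h1) (isBounded_partialDeriv Λ j
        (isBounded_of_compactlySupportedIn Λ h2))).toLp _ : L2 Λ) x
      = ((∫ x, partialDeriv j φ x * χ x : ℝ) : ℂ) := by
    rw [← integral_complex_ofReal, ← setIntegral_eq_integral_of_forall_compl_eq_zero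
      (s := (Λ : Set (Space d))) (f := fun x => ((partialDeriv j φ x * χ x : ℝ) : ℂ))
      (fun x hx => by simp [(hzero x hx).2])]
    refine integral_congr_ae ?_
    filter_upwards [MemLp.coeFn_toLp (memLp_ofReal Λ (continuous_partialDeriv j h1)
      (isBounded_partialDeriv Λ j (isBounded_of_compactlySupportedIn Λ h2)))] with x hx
    rw [hx]
    simp [mul_comm]
  change ∫ x in (Λ : Set (Space d)), partialDeriv j χ x •
      ((memLp_ofReal Λ h1.continuous (isBounded_of_compactlySupportedIn Λ h2)).toLp _ : L2 Λ) x
      = - ∫ x in (Λ : Set (Space d)), χ x •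
      ((memLp_ofReal Λ (continuous_partialDeriv j h1) (isBounded_partialDeriv Λ j
        (isBounded_of_compactlySupportedIn Λ h2))).toLp _ : L2 Λ) x
  rw [e1, e2, parts]
  simp

lemma test_mem_formGraph {d : ℕ} (a b : Fin d → EReal) (bc : BoundaryCondition)
    {φ : Space d → ℝ} (h1 : ContDiff ℝ ∞ φ) (h2 : CompactlySupportedIn (box a b) φ) :
    ∃ h, ((memLp_ofReal (box a b) h1.continuous
      (isBounded_of_compactlySupportedIn (box a b) h2)).toLp _, h) ∈ formGraph a b bc := by
  have hP := fun P => test_mem_partsGraph (box a b) P h1 h2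
  refine ⟨WithLp.toLp 2 fun j => (memLp_ofReal (box a b) (continuous_partialDeriv j h1)
    (isBounded_partialDeriv _ j (isBounded_of_compactlySupportedIn _ h2))).toLp _, ?_⟩
  · cases bc with
    | neumann => exact hP _
    | periodic => exact ⟨hP _, hP _⟩
    | dirichlet =>
      refine ⟨Submodule.le_topologicalClosure _ ⟨hP _, ?_⟩, hP _⟩
      refine ⟨fun x => (φ x : ℂ), Complex.ofRealCLM.contDiff.comp h1, ⟨?_, ?_⟩,
        MemLp.coeFn_toLp (memLp_ofReal (box a b) h1.continuous
          (isBounded_of_compactlySupportedIn (box a b) h2))⟩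
      · exact h2.1.comp_left (g := fun r : ℝ => (r : ℂ)) Complex.ofReal_zero
      · exact (tsupport_comp_subset (g := fun r : ℝ => (r : ℂ)) Complex.ofReal_zero φ).trans h2.2

lemma formGraph_le {d : ℕ} (a b : Fin d → EReal) (bc : BoundaryCondition) :
    formGraph a b bc ≤ gradGraph (box a b) := by
  cases bc
  · exact inf_le_right
  · exact le_rfl
  · exact inf_le_left

lemma laplacianGraph_single_valued {d : ℕ} (a b : Fin d → EReal) (bc : BoundaryCondition)
    (p : L2 (box a b) × L2 (box a b)) (hp : p ∈ laplacianGraph a b bc) (h0 : p.1 = 0) :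
    p.2 = 0 := by
  obtain ⟨g, hg, h⟩ := hp
  have hg0 : g = 0 := gradGraph_single_valued _ _ (formGraph_le a b bc hg) h0
  refine eq_zero_of_forall_test _ _ fun φ h1 h2 => ?_
  obtain ⟨k, hk⟩ := test_mem_formGraph a b bc h1 h2
  have h3 := h _ _ hk
  rw [hg0, inner_zero_right, inner_neg_right, eq_comm, neg_eq_zero, L2.inner_def] at h3
  rw [← h3]
  refine integral_congr_ae ?_
  filter_upwards [MemLp.coeFn_toLp (memLp_ofReal (box a b) h1.continuous
    (isBounded_of_compactlySupportedIn (box a b) h2))] with x hx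
  rw [hx]
  simp [mul_comm]

/-- The graph of the Laplacian consists exactly of the pairs `(u, Δu)`. -/
theorem laplacian_graph {d : ℕ} (a b : Fin d → EReal) (bc : BoundaryCondition) :
    (laplacian a b bc).graph = laplacianGraph a b bc :=
  Submodule.toLinearPMap_graph_eq _ (laplacianGraph_single_valued a b bc)

end GenRect

end

/-!
The pairs `(u, ∇u)` form a closed subspace, being cut out by equations `∫ (∂_j φ) u = - ∫ φ ∂_j u`
that are continuous in `u` and `∇u`, and multiplication by `V` is closed because `L²`-convergence
implies almost everywhere convergence along a subsequence. The closed graph theorem hence turns the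
inclusion `H¹(Λ) ⊆ D(V)` into a bound `‖V ψ‖ ≤ M (‖∇ψ‖ + ‖ψ‖)`. Squaring it gives (b); for (a),
insert `‖∇ψ‖² = ⟨ψ, -Δψ⟩ ≤ ‖ψ‖ ‖Δψ‖ ≤ (ε ‖Δψ‖ + ‖ψ‖ / ε)²`.
-/

namespace GenRect

open Filter Topology

section RelativeBound

variable {𝕜 X Y Z W : Type*} [NontriviallyNormedField 𝕜]
  [NormedAddCommGroup X] [NormedSpace 𝕜 X] [NormedAddCommGroup Y] [NormedSpace 𝕜 Y]
  [NormedAddCommGroup Z] [NormedSpace 𝕜 Z] [NormedAddCommGroup W] [NormedSpace 𝕜 W]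

/-- `B` is relatively bounded with respect to `A`, with constants `η` and `C`: the domain of `B`
contains that of `A`, where `‖B x‖ ≤ η ‖A x‖ + C ‖x‖`. The constants are part of the predicate since
their joint dependence on a parameter matters below. -/
structure HasRelativeBound (B : X →ₗ.[𝕜] Z) (A : X →ₗ.[𝕜] Y) (η C : ℝ) : Prop where
  domain_le : A.domain ≤ B.domain
  norm_le : ∀ x : A.domain, ‖B ⟨x, domain_le x.2⟩‖ ≤ η * ‖A x‖ + C * ‖(x : X)‖

theorem exists_hasRelativeBound_of_isClosed_of_isClosable [CompleteSpace X] [CompleteSpace Y]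
    [CompleteSpace Z] {D : X →ₗ.[𝕜] Y} {B : X →ₗ.[𝕜] Z} (hD : D.IsClosed) (hB : B.IsClosable)
    (hDB : D.domain ≤ B.domain) : ∃ M : ℝ, 0 ≤ M ∧ HasRelativeBound B D M M := by
  have : CompleteSpace D.graph := hD.completeSpace_coe
  have hmem (p : D.graph) : p.1.1 ∈ B.domain := hDB (LinearPMap.mem_domain_of_mem_graph p.2)
  let T : D.graph →ₗ[𝕜] Z :=
    B.toFun ∘ₗ (LinearMap.fst 𝕜 X Y ∘ₗ D.graph.subtype).codRestrict B.domain hmem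
  have hTB (p : D.graph) : (p.1.1, T p) ∈ B.closure.graph :=
    LinearPMap.le_graph_of_le B.le_closure (B.mem_graph ⟨p.1.1, hmem p⟩)
  have hT : Continuous T := by
    refine T.continuous_of_isClosed_graph ?_
    have hgraph : (T.graph : Set (D.graph × Z)) =
        (fun q : D.graph × Z => (q.1.1.1, q.2)) ⁻¹' B.closure.graph := by
      ext ⟨p, z⟩
      simp only [SetLike.mem_coe, LinearMap.mem_graph_iff, Set.mem_preimage]
      exact ⟨fun h => h ▸ hTB p, fun h => B.closure.mem_graph_snd_inj h (hTB p) rfl⟩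
    rw [hgraph]
    exact hB.closure_isClosed.preimage (by fun_prop)
  let S : D.graph →L[𝕜] Z := ⟨T, hT⟩
  refine ⟨‖S‖, norm_nonneg S, hDB, fun x => ?_⟩
  calc ‖B ⟨x, hDB x.2⟩‖ ≤ ‖S‖ * max ‖(x : X)‖ ‖D x‖ := S.le_opNorm ⟨_, D.mem_graph x⟩
    _ ≤ ‖S‖ * (‖D x‖ + ‖(x : X)‖) := by
        gcongr
        rw [add_comm]
        exact max_le_add_of_nonneg (norm_nonneg _) (norm_nonneg _)
    _ = ‖S‖ * ‖D x‖ + ‖S‖ * ‖(x : X)‖ := mul_add _ _ _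

theorem HasRelativeBound.norm_sq_le {B : X →ₗ.[𝕜] Z} {A : X →ₗ.[𝕜] Y} {η C : ℝ}
    (h : HasRelativeBound B A η C) (x : A.domain) :
    ‖B ⟨x, h.domain_le x.2⟩‖ ^ 2 ≤ 2 * η ^ 2 * ‖A x‖ ^ 2 + 2 * C ^ 2 * ‖(x : X)‖ ^ 2 :=
  calc ‖B ⟨x, h.domain_le x.2⟩‖ ^ 2 ≤ (η * ‖A x‖ + C * ‖(x : X)‖) ^ 2 := by
        gcongr
        exact h.norm_le x
    _ ≤ 2 * ((η * ‖A x‖) ^ 2 + (C * ‖(x : X)‖) ^ 2) := add_sq_le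
    _ = 2 * η ^ 2 * ‖A x‖ ^ 2 + 2 * C ^ 2 * ‖(x : X)‖ ^ 2 := by ring

lemma le_mul_add_div_of_sq_le_mul {x y z ε : ℝ} (hx : 0 ≤ x) (hz : 0 ≤ z) (hε : 0 < ε)
    (h : y ^ 2 ≤ x * z) : y ≤ ε * z + x / ε := by
  have hxz : x * z = (ε * z) * (x / ε) := by field_simp
  have hεz : 0 ≤ ε * z := by positivity
  have hxε : 0 ≤ x / ε := by positivity
  have hsq : y ^ 2 ≤ (ε * z + x / ε) ^ 2 := by nlinarith
  exact (abs_le_of_sq_le_sq' hsq (by positivity)).2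

theorem HasRelativeBound.of_norm_sq_le_mul {B : X →ₗ.[𝕜] Z} {D : X →ₗ.[𝕜] Y} {A : X →ₗ.[𝕜] W}
    {M N ε : ℝ} (h : HasRelativeBound B D M N) (hM : 0 ≤ M) (hAD : A.domain ≤ D.domain)
    (hDA : ∀ x : A.domain, ‖D ⟨x, hAD x.2⟩‖ ^ 2 ≤ ‖(x : X)‖ * ‖A x‖) (hε : 0 < ε) :
    HasRelativeBound B A (M * ε) (M / ε + N) where
  domain_le := hAD.trans h.domain_le
  norm_le x :=
    calc ‖B ⟨x, _⟩‖ ≤ M * ‖D ⟨x, hAD x.2⟩‖ + N * ‖(x : X)‖ := h.norm_le ⟨x, hAD x.2⟩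
      _ ≤ M * (ε * ‖A x‖ + ‖(x : X)‖ / ε) + N * ‖(x : X)‖ := by
          gcongr
          exact le_mul_add_div_of_sq_le_mul (norm_nonneg _) (norm_nonneg _) hε (hDA x)
      _ = M * ε * ‖A x‖ + (M / ε + N) * ‖(x : X)‖ := by ring

end RelativeBound

theorem IsInfinitesimallyBounded.of_hasRelativeBound_mul {X Y Z : Type*}
    [NormedAddCommGroup X] [NormedSpace ℂ X] [NormedAddCommGroup Y] [NormedSpace ℂ Y]
    [NormedAddCommGroup Z] [NormedSpace ℂ Z] {B : X →ₗ.[ℂ] Z} {A : X →ₗ.[ℂ] Y}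
    {α : ℝ} (h : ∀ ε : ℝ, 0 < ε → ∃ C : ℝ, HasRelativeBound B A (α * ε) C) :
    IsInfinitesimallyBounded B A := by
  obtain ⟨_, hone⟩ := h 1 one_pos
  refine ⟨hone.domain_le, fun η hη => ?_⟩
  obtain ⟨C, hC⟩ := h (η / (|α| + 1)) (by positivity)
  have hαη : α * (η / (|α| + 1)) ≤ η := by
    rw [mul_div_assoc', div_le_iff₀ (by positivity), mul_comm α η]
    gcongr
    linarith [le_abs_self α]
  refine ⟨max C 0, le_max_right _ _, fun x hA _ => (hC.norm_le ⟨x, hA⟩).trans ?_⟩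
  gcongr
  exact le_max_left _ _

theorem isClosed_setOf_ae_mem {α E F : Type*} [MeasurableSpace α] {μ : Measure α}
    [NormedAddCommGroup E] [NormedAddCommGroup F] {p q : ENNReal} [Fact (1 ≤ p)] [Fact (1 ≤ q)]
    {R : α → Set (E × F)} (hR : ∀ᵐ x ∂μ, IsClosed (R x)) :
    IsClosed {w : Lp E p μ × Lp F q μ | ∀ᵐ x ∂μ, (w.1 x, w.2 x) ∈ R x} := by
  refine IsSeqClosed.isClosed fun w v hw hwv => ?_
  obtain ⟨k, hk, hfst⟩ := (tendstoInMeasure_of_tendsto_Lp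
    ((continuous_fst.tendsto v).comp hwv)).exists_seq_tendsto_ae
  obtain ⟨l, hl, hsnd⟩ := (tendstoInMeasure_of_tendsto_Lp
    (((continuous_snd.tendsto v).comp hwv).comp hk.tendsto_atTop)).exists_seq_tendsto_ae
  filter_upwards [hR, hfst, hsnd, ae_all_iff.2 hw] with x hRx hfstx hsndx hwx
  exact hRx.mem_of_tendsto ((hfstx.comp hl.tendsto_atTop).prodMk_nhds hsndx)
    (Eventually.of_forall fun n => hwx _)

section Closedness

variable {d : ℕ} (Λ : Opens (Space d))

lemma mem_graph_mulOp_iff {V : Space d → ℝ} {u w : L2 Λ} :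
    (u, w) ∈ (mulOp Λ V).graph ↔
      w =ᵐ[volume.restrict (Λ : Set (Space d))] fun x => (V x : ℂ) * u x := by
  rw [LinearPMap.mem_graph_iff]
  constructor
  · rintro ⟨ψ, rfl, rfl⟩
    exact coeFn_mulFun Λ V ψ ψ.2
  · intro h
    have hu : u ∈ mulDomain Λ V := (memLp_congr_ae h).1 (Lp.memLp w)
    exact ⟨⟨u, hu⟩, rfl, Lp.ext ((coeFn_mulFun Λ V u hu).trans h.symm)⟩

theorem isClosed_mulOp (V : Space d → ℝ) : (mulOp Λ V).IsClosed := by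
  have hgraph : ((mulOp Λ V).graph : Set (L2 Λ × L2 Λ)) =
      {w | ∀ᵐ x ∂volume.restrict (Λ : Set (Space d)),
        (w.1 x, w.2 x) ∈ {z : ℂ × ℂ | z.2 = V x * z.1}} :=
    Set.ext fun _ => mem_graph_mulOp_iff Λ
  rw [LinearPMap.IsClosed, hgraph]
  exact isClosed_setOf_ae_mem (Eventually.of_forall fun x =>
    isClosed_eq continuous_snd (continuous_const.mul continuous_fst))

lemma continuous_setIntegral_smul {φ : Space d → ℝ} (hφ : Continuous φ)
    (hb : Bornology.IsBounded ((Λ : Set (Space d)) ∩ Function.support φ)) :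
    Continuous fun u : L2 Λ => ∫ x in (Λ : Set (Space d)), φ x • u x := by
  have hinner (u : L2 Λ) : inner ℂ ((memLp_ofReal Λ hφ hb).toLp _ : L2 Λ) u =
      ∫ x in (Λ : Set (Space d)), φ x • u x := by
    rw [L2.inner_def]
    refine integral_congr_ae ?_
    filter_upwards [(memLp_ofReal Λ hφ hb).coeFn_toLp] with x hx
    simp [hx, mul_comm]
  simp only [← hinner]
  fun_prop

theorem isClosed_partsGraph (P : (Space d → ℝ) → Prop) :
    IsClosed (partsGraph Λ P : Set (L2 Λ × L2Field Λ)) := by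
  have hinter : (partsGraph Λ P : Set (L2 Λ × L2Field Λ)) =
      ⋂ (j : Fin d) (φ : Space d → ℝ) (_ : ContDiff ℝ ∞ φ)
        (_ : Bornology.IsBounded ((Λ : Set (Space d)) ∩ Function.support φ)) (_ : P φ),
        {p | ∫ x in (Λ : Set (Space d)), partialDeriv j φ x • p.1 x
          = - ∫ x in (Λ : Set (Space d)), φ x • p.2 j x} := by
    ext p
    simp only [Set.mem_iInter]
    rfl
  rw [hinter]
  refine isClosed_iInter fun j => isClosed_iInter fun φ => isClosed_iInter fun hφ =>
    isClosed_iInter fun hb => isClosed_iInter fun _ => isClosed_eq ?_ ?_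
  · exact (continuous_setIntegral_smul Λ (continuous_partialDeriv j hφ)
      (isBounded_partialDeriv Λ j hb)).comp continuous_fst
  · exact ((continuous_setIntegral_smul Λ hφ.continuous hb).comp
      ((PiLp.continuous_apply 2 (fun _ : Fin d => L2 Λ) j).comp continuous_snd)).neg

theorem isClosed_grad : (grad Λ).IsClosed := by
  rw [LinearPMap.IsClosed, grad_graph]
  exact isClosed_partsGraph Λ _

end Closedness

section Laplacian

variable {d : ℕ} {a b : Fin d → EReal} {bc : BoundaryCondition}

lemma exists_mem_graph_grad (ψ : (laplacian a b bc).domain) :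
    ∃ g, ((ψ : L2 (box a b)), g) ∈ (grad (box a b)).graph ∧
      inner ℂ g g = inner ℂ (ψ : L2 (box a b)) (-laplacian a b bc ψ) := by
  have hψ := (laplacian a b bc).mem_graph ψ
  rw [laplacian_graph] at hψ
  obtain ⟨g, hg, hgreen⟩ := hψ
  exact ⟨g, grad_graph (box a b) ▸ formGraph_le a b bc hg, hgreen _ _ hg⟩

lemma laplacian_domain_le_grad_domain : (laplacian a b bc).domain ≤ (grad (box a b)).domain :=
  fun ψ hψ =>
    let ⟨_, hg, _⟩ := exists_mem_graph_grad ⟨ψ, hψ⟩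
    LinearPMap.mem_domain_of_mem_graph hg

lemma inner_grad_self (ψ : (laplacian a b bc).domain) :
    inner ℂ (grad (box a b) ⟨ψ, laplacian_domain_le_grad_domain ψ.2⟩)
        (grad (box a b) ⟨ψ, laplacian_domain_le_grad_domain ψ.2⟩) =
      inner ℂ (ψ : L2 (box a b)) (-laplacian a b bc ψ) := by
  obtain ⟨g, hg, hgreen⟩ := exists_mem_graph_grad ψ
  rwa [← (LinearPMap.image_iff _).2 hg]

theorem norm_grad_sq_le (ψ : (laplacian a b bc).domain) :
    ‖grad (box a b) ⟨ψ, laplacian_domain_le_grad_domain ψ.2⟩‖ ^ 2 ≤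
      ‖(ψ : L2 (box a b))‖ * ‖laplacian a b bc ψ‖ := by
  rw [← norm_neg (laplacian a b bc ψ), ← inner_self_eq_norm_sq (𝕜 := ℂ), inner_grad_self]
  exact re_inner_le_norm _ _

end Laplacian

end GenRect

theorem lemma4p1 {d : ℕ} (a b : Fin d → EReal) (hab : ∀ j, a j < b j)
    (V : GenRect.Space d → ℝ) (hV : GenRect.IsAdmissible (GenRect.box a b) V) :
    (∀ bc : GenRect.BoundaryCondition, bc.Applicable a b →
      GenRect.IsInfinitesimallyBounded (GenRect.mulOp (GenRect.box a b) V)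
        (GenRect.laplacian a b bc) ∧
      ∃ α β : ℝ, 0 ≤ α ∧ 0 ≤ β ∧
        ∀ (ψ : (GenRect.laplacian a b bc).domain) (ε : ℝ), 0 < ε →
          ∃ hψ : (ψ : GenRect.L2 (GenRect.box a b)) ∈
              (GenRect.mulOp (GenRect.box a b) V).domain,
            ‖GenRect.mulOp (GenRect.box a b) V ⟨ψ, hψ⟩‖ ≤
              α * ε * ‖GenRect.laplacian a b bc ψ‖ +
                (α / ε + β) * ‖(ψ : GenRect.L2 (GenRect.box a b))‖) ∧
    ∃ l₁ l₂ : ℝ, 0 ≤ l₁ ∧ 0 ≤ l₂ ∧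
      ∀ ψ : (GenRect.grad (GenRect.box a b)).domain,
        ∃ hψ : (ψ : GenRect.L2 (GenRect.box a b)) ∈
            (GenRect.mulOp (GenRect.box a b) V).domain,
          ‖GenRect.mulOp (GenRect.box a b) V ⟨ψ, hψ⟩‖ ^ 2 ≤
            l₁ * ‖GenRect.grad (GenRect.box a b) ψ‖ ^ 2 +
              l₂ * ‖(ψ : GenRect.L2 (GenRect.box a b))‖ ^ 2 := by
  obtain ⟨M, hM, hgrad⟩ := GenRect.exists_hasRelativeBound_of_isClosed_of_isClosable
    (GenRect.isClosed_grad _) (GenRect.isClosed_mulOp _ V).isClosable hV.2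
  refine ⟨fun bc _ => ?_, 2 * M ^ 2, 2 * M ^ 2, by positivity, by positivity,
    fun ψ => ⟨hgrad.domain_le ψ.2, hgrad.norm_sq_le ψ⟩⟩
  have hlap (ε : ℝ) (hε : 0 < ε) : GenRect.HasRelativeBound
      (GenRect.mulOp (GenRect.box a b) V) (GenRect.laplacian a b bc) (M * ε) (M / ε + M) :=
    hgrad.of_norm_sq_le_mul hM GenRect.laplacian_domain_le_grad_domain GenRect.norm_grad_sq_le hε
  exact ⟨.of_hasRelativeBound_mul fun ε hε => ⟨_, hlap ε hε⟩, M, M, hM, hM,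
    fun ψ ε hε => ⟨(hlap ε hε).domain_le ψ.2, (hlap ε hε).norm_le ψ⟩⟩
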